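/- \textbf{Setting.} Let $\Lambda^\delta=\Gamma^{\bullet,\delta}\cup\Gamma^{\circ,\delta}$ be an isoradial grid of mesh size $\delta>0$, i.e. a face-to-face tiling of $\mathbb C$ by rhombi with side $\delta$ whose vertices are coloured black ($\Gamma^{\bullet,\delta}$) and white ($\Gamma^{\circ,\delta}$) so that each side joins a black vertex to a white one. It satisfies $\mathrm{BAP}(\theta_0)$ if no rhombus has an angle smaller than $2\theta_0$. For a rhombus $z=(v_0u_0v_1u_1)$ with $v_p$ black and $u_q$ white, let $\theta_z$ be half of its angle at $v_0$, and for $m\in\mathbb R$ let $\widehat\theta_z\in(0,\frac\pi2)$ be given by $\sin\widehat\theta_z=\mathrm{sn}\big(\frac{2K}{\pi}\theta_z\,|\,k\big)$, where $k$ is the elliptic modulus with nome $q=\frac12m\delta$ and $K=K(k)$. A corner is an edge $c=(u(c)v(c))$ of $\Lambda^\delta$, with $v(c)$ black and $u(c)$ white; $\Upsilon^\times$ is the double cover of the graph of corners (two corners of a rhombus being adjacent if they share a vertex) that branches around every vertex and every rhombus of $\Lambda^\delta$, and a spinor is a function $X:\Upsilon^\times\to\mathbb R$ whose values at the two lifts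 of a corner differ by the sign. The propagation equation at $z$ is $$X(c_{pq})=X(c_{p,1-q})\cos\widehat\theta_z+X(c_{1-p,q})\sin\widehat\theta_z,\qquad p,q\in\{0,1\},$$ where $c_{pq}$ is a lift of $(u_qv_p)$ and $c_{p,1-q}$, $c_{1-p,q}$ are its neighbours on $\Upsilon^\times$. A function $H$ on $\Lambda^\delta$ is constructed from $X$ at $z$ if $H(v_p)-H(u_q)=X(c_{pq})^2$ for all $p,q\in\{0,1\}$. For $v\in\Gamma^{\bullet,\delta}$ with incident rhombi $z_1,\dots,z_n$, let $\theta_s=\theta_{z_s}$, let $v_s$ be the vertex of $z_s$ opposite to $v$, and put $$[\Delta^{\bullet,\delta}H](v)=\mu^\delta(v)^{-1}\sum_{s=1}^n\tan\theta_s\,\big(H(v_s)-H(v)\big),\qquad \mu^\delta(v)=\tfrac12\delta^2\sum_{s=1}^n\sin2\theta_s .$$ \textbf{Proposition.} For each $\theta_0>0$ there is $\varepsilon=\varepsilon(\theta_0)>0$ such that the following holds for all $m\le0$ and $\delta>0$ with $|m|\delta\le\varepsilon$ (that is, for each fixed $m\le 0$, for all small enough $\delta$) and for each isoradial grid $\Lambda^\delta$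 of mesh size $\delta$ satisfying $\mathrm{BAP}(\theta_0)$. If $v\in\Gamma^{\bullet,\delta}$, if a spinor $X$ satisfies the propagation equation at all rhombi incident to $v$, and if $H$ is constructed from $X$ at these rhombi, then $[\Delta^{\bullet,\delta}H](v)\ge0$. In particular, if $X$ satisfies the propagation equation at all rhombi of $\Lambda^\delta$ and $H$ is constructed from $X$ at all of them, then $H$ is discrete subharmonic on $\Gamma^{\bullet,\delta}$, i.e. $[\Delta^{\bullet,\delta}H](v)\ge0$ for all $v\in\Gamma^{\bullet,\delta}$. -/

import Mathlib

open scoped ComplexConjugate EuclideanGeometry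

noncomputable section

/-! ### Elliptic parametrisation of the Z-invariant weights by the (real) nome `q` -/

/-- `θ₁(z, q) / (2 q^{1/4}) = ∑ (-1)ⁿ q^{n(n+1)} sin((2n+1)z)`.  The factor `2 q^{1/4}`, common to
`θ₁(·, q)` and `θ₂(·, q)`, is divided out, so that the nome `q` may be negative. -/
def theta1Red (z q : ℝ) : ℝ :=
  ∑' n : ℕ, (-1) ^ n * q ^ (n * (n + 1)) * Real.sin ((2 * n + 1) * z)

/-- `θ₂(z, q) / (2 q^{1/4}) = ∑ q^{n(n+1)} cos((2n+1)z)`. -/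
def theta2Red (z q : ℝ) : ℝ :=
  ∑' n : ℕ, q ^ (n * (n + 1)) * Real.cos ((2 * n + 1) * z)

/-- `θ₃(z, q) = 1 + 2 ∑_{n ≥ 1} q^{n²} cos(2nz)`. -/
def theta3 (z q : ℝ) : ℝ :=
  1 + 2 * ∑' n : ℕ, q ^ ((n + 1) ^ 2) * Real.cos (2 * (n + 1) * z)

/-- `θ₄(z, q) = 1 + 2 ∑_{n ≥ 1} (-1)ⁿ q^{n²} cos(2nz)`. -/
def theta4 (z q : ℝ) : ℝ :=
  1 + 2 * ∑' n : ℕ, (-1) ^ (n + 1) * q ^ ((n + 1) ^ 2) * Real.cos (2 * (n + 1) * z)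

/-- The complete elliptic integral of the first kind as a function of the nome,
`K = (π/2) θ₃(0, q)²`. -/
def ellipticK (q : ℝ) : ℝ := Real.pi / 2 * theta3 0 q ^ 2

/-- The Jacobi elliptic function `sn(w | k)`, where `k` is the modulus with nome `q`:
`sn(w | k) = (θ₃(0,q) / θ₂(0,q)) · (θ₁(ζ,q) / θ₄(ζ,q))` with `ζ = π w / (2K)`. -/
def jacobiSn (q w : ℝ) : ℝ :=
  theta3 0 q / theta2Red 0 q *
    (theta1Red (Real.pi * w / (2 * ellipticK q)) q / theta4 (Real.pi * w / (2 * ellipticK q)) q)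

/-- The Z-invariant Ising angle `θ̂ ∈ (0, π/2)` attached to the geometric half-angle `θ`:
`sin θ̂ = sn((2K/π) θ | k)`, where `k` is the modulus with nome `q`. -/
def isingAngle (q θ : ℝ) : ℝ := Real.arcsin (jacobiSn q (2 * ellipticK q / Real.pi * θ))

/-! ### Isoradial grids (rhombic tilings) -/

/-- A quad `z = (v₀ u₀ v₁ u₁)`, with black vertices `v p` and white vertices `u q`, listed
counterclockwise. -/
@[ext]
structure Quad where
  v : Fin 2 → ℂ
  u : Fin 2 → ℂ

namespace Quad

/-- The other labelling `(v₁ u₁ v₀ u₀)` of the same quad. -/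
def swap (z : Quad) : Quad := ⟨fun p => z.v (p + 1), fun q => z.u (q + 1)⟩

/-- The closed region of the plane occupied by the quad. -/
def region (z : Quad) : Set ℂ := convexHull ℝ {z.v 0, z.u 0, z.v 1, z.u 1}

/-- The half-angle `θ_z` of the quad at its black vertices. -/
def halfAngle (z : Quad) : ℝ := ∠ (z.u 0) (z.v 0) (z.u 1) / 2

/-- The quad is a nondegenerate rhombus with side `δ`, listed counterclockwise. -/
structure IsRhombus (δ : ℝ) (z : Quad) : Prop where
  side : ∀ p q, dist (z.v p) (z.u q) = δ
  parallelogram : z.v 0 + z.v 1 = z.u 0 + z.u 1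
  ccw : 0 < ((z.u 1 - z.v 0) / (z.u 0 - z.v 0)).im

end Quad

/-- An isoradial grid `Λ = Γ• ∪ Γ°` of mesh size `δ`: a face-to-face tiling of the plane by rhombi
with side `δ`, whose vertices are coloured black (`Γ•`) and white (`Γ°`) in such a way that every
side joins a black vertex to a white one. -/
structure IsoradialGrid (δ : ℝ) where
  /-- the vertex set `Γ•` -/
  black : Set ℂ
  /-- the vertex set `Γ°` -/
  white : Set ℂ
  /-- the rhombi; each of them occurs with both of its labellings -/
  quads : Set Quad
  disjoint_colours : Disjoint black white
  black_mem : ∀ z ∈ quads, ∀ p, z.v p ∈ black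
  white_mem : ∀ z ∈ quads, ∀ q, z.u q ∈ white
  swap_mem : ∀ z ∈ quads, z.swap ∈ quads
  rhombus : ∀ z ∈ quads, z.IsRhombus δ
  /-- the rhombi cover the plane -/
  cover : ∀ x : ℂ, ∃ z ∈ quads, x ∈ z.region
  /-- distinct rhombi have disjoint interiors -/
  interior_disjoint : ∀ z ∈ quads, ∀ z' ∈ quads, z' ≠ z → z' ≠ z.swap →
    Disjoint (interior z.region) (interior z'.region)
  /-- Face-to-face condition at a black vertex `v`: its white neighbours
  `u 0, …, u (n - 1), u n = u 0`, in counterclockwise order, are such that the rhombi at `v` are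
  exactly those spanned at `v` by `u s` and `u (s + 1)`; together they make one full turn. -/
  black_star : ∀ v ∈ black, ∃ (n : ℕ) (u : ℕ → ℂ), u n = u 0 ∧
    {z ∈ quads | z.v 0 = v} =
      {z | ∃ s < n, z = ⟨![v, u s + u (s + 1) - v], ![u s, u (s + 1)]⟩} ∧
    ∑ s ∈ Finset.range n, ∠ (u s) v (u (s + 1)) = 2 * Real.pi
  /-- The same condition at a white vertex `w`. -/
  white_star : ∀ w ∈ white, ∃ (n : ℕ) (v : ℕ → ℂ), v n = v 0 ∧
    {z ∈ quads | z.u 0 = w} =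
      {z | ∃ s < n, z = ⟨![v (s + 1), v s], ![w, v s + v (s + 1) - w]⟩} ∧
    ∑ s ∈ Finset.range n, ∠ (v s) w (v (s + 1)) = 2 * Real.pi

namespace IsoradialGrid

variable {δ : ℝ} (Λ : IsoradialGrid δ)

/-- The bounded angle property: no rhombus has an angle smaller than `2θ₀`. -/
def BAP (θ₀ : ℝ) : Prop :=
  ∀ z ∈ Λ.quads, 2 * θ₀ ≤ ∠ (z.u 0) (z.v 0) (z.u 1) ∧ 2 * θ₀ ≤ ∠ (z.v 0) (z.u 0) (z.v 1)

/-- `(v u)` is an edge of `Λ` (`v` black, `u` white), i.e. a corner `c ∈ Υ` with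
`v(c) = v`, `u(c) = u`. -/
def IsCorner (v u : ℂ) : Prop := ∃ z ∈ Λ.quads, ∃ p q, z.v p = v ∧ z.u q = u

/-- The double cover `Υ^×` of the set of corners, branching around every vertex and every quad of
`Λ`: a lift of the corner `(v u)` is a choice of one of the two values
`η = ± e^{iπ/4} exp(-(i/2) arg (v - u))`, i.e. of a square root of
`i exp(-i arg (v - u)) = i · conj (v - u) / δ`. -/
@[ext]
structure CornerLift where
  v : ℂ
  u : ℂ
  η : ℂ
  isCorner : Λ.IsCorner v u
  η_sq : η ^ 2 = Complex.I * conj (v - u) / δ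

variable {Λ}

/-- The other lift of the same corner. -/
def CornerLift.flip (c : Λ.CornerLift) : Λ.CornerLift :=
  ⟨c.v, c.u, -c.η, c.isCorner, by rw [neg_sq, c.η_sq]⟩

/-- For two corners of one quad that share a vertex, the direction of `v - u` turns by an angle of
absolute value less than `π` from one corner to the other; their lifts are neighbours on `Υ^×` if
`η` turns by half of that angle, i.e. by less than `π/2` (and not by that angle plus `π`). -/
def CornerLift.Neighbor (c c' : Λ.CornerLift) : Prop := 0 < (c.η * conj c'.η).re

/-- `c` is a lift of the corner `c_{pq} = (v_p u_q)` of the quad `z`. -/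
def CornerLift.Over (c : Λ.CornerLift) (z : Quad) (p q : Fin 2) : Prop :=
  c.v = z.v p ∧ c.u = z.u q

/-- Real-valued spinors on `Υ^×`: the values at the two lifts of a corner differ by the sign. -/
def IsSpinor (X : Λ.CornerLift → ℝ) : Prop := ∀ c, X c.flip = -X c

/-- The propagation equation at the quad `z`, for the Z-invariant model of mass `m`, whose nome is
`q = mδ/2`: `X(c_{pq}) = X(c_{p,1-q}) cos θ̂_z + X(c_{1-p,q}) sin θ̂_z` for each corner `c_{pq}` of `z`
and its neighbours `c_{p,1-q}`, `c_{1-p,q}` on `Υ^×` (here `p + 1 = 1 - p` in `Fin 2`). -/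
def PropagationAt (m : ℝ) (X : Λ.CornerLift → ℝ) (z : Quad) : Prop :=
  ∀ (p q : Fin 2) (c c' c'' : Λ.CornerLift),
    c.Over z p q → c'.Over z p (q + 1) → c''.Over z (p + 1) q →
    c.Neighbor c' → c.Neighbor c'' →
    X c = X c' * Real.cos (isingAngle (m * δ / 2) z.halfAngle) +
      X c'' * Real.sin (isingAngle (m * δ / 2) z.halfAngle)

/-- `H` has the increments `H(v_p) - H(u_q) = X(c_{pq})²` along the sides of the quad `z`. -/
def PrimitiveAt (X : Λ.CornerLift → ℝ) (H : ℂ → ℝ) (z : Quad) : Prop :=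
  ∀ (p q : Fin 2) (c : Λ.CornerLift), c.Over z p q → H (z.v p) - H (z.u q) = X c ^ 2

variable (Λ)

/-- The rhombi with vertex `v`, for a black vertex `v`, each labelled so that `v₀ = v` (and thus
occurring once). -/
def quadsAt (v : ℂ) : Set Quad := {z ∈ Λ.quads | z.v 0 = v}

/-- The normalising factor `μ(v) = (δ²/2) ∑_s sin 2θ_s`. -/
def laplacianWeight (v : ℂ) : ℝ :=
  δ ^ 2 / 2 * ∑ᶠ z ∈ Λ.quadsAt v, Real.sin (2 * z.halfAngle)

/-- The discrete Laplacian on `Γ•`: `μ(v)⁻¹ ∑_s tan θ_s (H(v_s) - H(v))`, where `v_s` runs through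
the neighbours of `v` in `Γ•`, i.e. the opposite vertices of the rhombi at `v`. -/
def laplacian (H : ℂ → ℝ) (v : ℂ) : ℝ :=
  (Λ.laplacianWeight v)⁻¹ * ∑ᶠ z ∈ Λ.quadsAt v, Real.tan z.halfAngle * (H (z.v 1) - H v)

/-- Discrete subharmonicity on `Γ•`. -/
def SubharmonicOnBlack (H : ℂ → ℝ) : Prop := ∀ v ∈ Λ.black, 0 ≤ Λ.laplacian H v

end IsoradialGrid

end

/-! Let `x s` be the values of `X` at the corners around `v`, followed continuously on the double
cover. The half-angles at `v` add up to `π`, so one full turn changes the lift: `x n = -x 0`.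
Propagation expresses the increment of `H` across each rhombus through `x s` and `x (s + 1)`, which
makes the Laplacian a sum of quadratic forms in consecutive values, one per rhombus. At criticality
(`θ̂ = θ`) these are the forms `edgeForm`. Consecutive edges merge without increasing the sum
(`edgeForm_add_le`), until two edges with angles `θ` and `π - θ` remain; by antiperiodicity their
forms cancel (`sum_edgeForm_nonneg`). For `q = mδ/2 ≤ 0` each massive form dominates `l` times the
critical one, with the same `l = 1 - 4q` for all rhombi. Both forms are diagonal in `a + b`, `a -
b`, so this amounts to two scalar inequalities (`mul_edgeForm_le`). Put `c = cos θ`. As `sn` is `sin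
θ (1 + 4qc²) + O(q²)`, a factor `l = 1 - λq` works to first order when `4(1 - c) ≤ λ ≤ 4(1 + c)`; `λ
= 4` suits every angle. The bounded angle property keeps the slack above the `O(q²)` error. -/

/-! ### Theta series and `sn` to first order in the nome. -/

lemma abs_tsum_sub_zero_le_two_mul_sq {f : ℕ → ℝ} {q : ℝ} (hq : |q| ≤ 1 / 2)
    (hf : ∀ n, |f (n + 1)| ≤ |q| ^ (n + 2)) : |∑' n, f n - f 0| ≤ 2 * q ^ 2 := by
  have hg : HasSum (fun n : ℕ => |q| ^ (n + 2)) (|q| ^ 2 * (1 - |q|)⁻¹) := by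
    simpa only [pow_add, mul_comm] using
      (hasSum_geometric_of_lt_one (abs_nonneg q) (by linarith)).mul_left (|q| ^ 2)
  have hs : Summable fun n => f (n + 1) := Summable.of_norm_bounded hg.summable hf
  rw [((summable_nat_add_iff 1).1 hs).tsum_eq_zero_add, add_sub_cancel_left]
  refine (tsum_of_norm_bounded (f := fun n => f (n + 1)) hg hf).trans ?_
  rw [sq_abs, mul_comm]
  refine mul_le_mul_of_nonneg_right ?_ (sq_nonneg q)
  rw [inv_le_comm₀ (by linarith) two_pos]
  linarith

lemma abs_pow_mul_le {q x : ℝ} (hq : |q| ≤ 1 / 2) (hx : |x| ≤ 1) {k n : ℕ} (hk : n ≤ k) :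
    |q ^ k * x| ≤ |q| ^ n := by
  rw [abs_mul, abs_pow]
  calc |q| ^ k * |x| ≤ |q| ^ k * 1 := by gcongr
    _ ≤ |q| ^ n := by
      rw [mul_one]; exact pow_le_pow_of_le_one (abs_nonneg q) (by linarith) hk

lemma abs_neg_one_pow_mul_mul (q x : ℝ) (n k : ℕ) : |(-1) ^ n * q ^ k * x| = |q ^ k * x| := by
  rw [mul_assoc, abs_mul, abs_pow, abs_neg, abs_one, one_pow, one_mul]

lemma abs_theta1Red_sub_le {q : ℝ} (hq : |q| ≤ 1 / 2) (z : ℝ) :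
    |theta1Red z q - Real.sin z| ≤ 2 * q ^ 2 := by
  have h := abs_tsum_sub_zero_le_two_mul_sq
    (f := fun n : ℕ => (-1) ^ n * q ^ (n * (n + 1)) * Real.sin ((2 * n + 1) * z)) hq fun n => by
      rw [abs_neg_one_pow_mul_mul]
      exact abs_pow_mul_le hq (Real.abs_sin_le_one _) (by nlinarith)
  simpa [theta1Red] using h

lemma abs_theta2Red_sub_le {q : ℝ} (hq : |q| ≤ 1 / 2) (z : ℝ) :
    |theta2Red z q - Real.cos z| ≤ 2 * q ^ 2 := by
  have h := abs_tsum_sub_zero_le_two_mul_sq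
    (f := fun n : ℕ => q ^ (n * (n + 1)) * Real.cos ((2 * n + 1) * z)) hq fun n =>
      abs_pow_mul_le hq (Real.abs_cos_le_one _) (by nlinarith)
  simpa [theta2Red] using h

lemma abs_theta3_sub_le {q : ℝ} (hq : |q| ≤ 1 / 2) (z : ℝ) :
    |theta3 z q - (1 + 2 * q * Real.cos (2 * z))| ≤ 4 * q ^ 2 := by
  have h := abs_tsum_sub_zero_le_two_mul_sq
    (f := fun n : ℕ => q ^ ((n + 1) ^ 2) * Real.cos (2 * (n + 1) * z)) hq fun n =>
      abs_pow_mul_le hq (Real.abs_cos_le_one _) (by nlinarith)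
  simp only [Nat.cast_zero, zero_add, one_pow, pow_one, mul_one] at h
  rw [theta3]
  rw [abs_le] at h ⊢
  constructor <;> linarith [h.1, h.2]

lemma abs_theta4_sub_le {q : ℝ} (hq : |q| ≤ 1 / 2) (z : ℝ) :
    |theta4 z q - (1 - 2 * q * Real.cos (2 * z))| ≤ 4 * q ^ 2 := by
  have h := abs_tsum_sub_zero_le_two_mul_sq
    (f := fun n : ℕ => (-1) ^ (n + 1) * q ^ ((n + 1) ^ 2) * Real.cos (2 * (n + 1) * z)) hq
    fun n => by
      rw [abs_neg_one_pow_mul_mul]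
      exact abs_pow_mul_le hq (Real.abs_cos_le_one _) (by nlinarith)
  simp only [Nat.cast_zero, zero_add, one_pow, pow_one, mul_one] at h
  rw [theta4]
  rw [abs_le] at h ⊢
  constructor <;> linarith [h.1, h.2]

lemma ellipticK_pos {q : ℝ} (hq : |q| ≤ 1 / 100) : 0 < ellipticK q := by
  have h := abs_theta3_sub_le (by linarith : |q| ≤ 1 / 2) 0
  have h0 : 0 < theta3 0 q := by
    simp only [mul_zero, Real.cos_zero] at h
    rw [abs_le] at h hq
    nlinarith
  rw [ellipticK]
  positivity

/-- Each theta series is replaced by its terms of order at most one in `q` plus an error `eᵢ =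
O(q²)`; the quotient of the main terms agrees with the claimed expansion to first order. -/
lemma abs_jacobiSn_sub_le {q : ℝ} (hq : |q| ≤ 1 / 100) (θ : ℝ) :
    |jacobiSn q (2 * ellipticK q / Real.pi * θ) -
      Real.sin θ * (1 + 4 * q * Real.cos θ ^ 2)| ≤ 60 * q ^ 2 := by
  have hq' : |q| ≤ 1 / 2 := by linarith
  have hK := (ellipticK_pos hq).ne'
  have hζ : Real.pi * (2 * ellipticK q / Real.pi * θ) / (2 * ellipticK q) = θ := by
    field_simp
  obtain ⟨e₁, he₁⟩ : ∃ e, theta1Red θ q = Real.sin θ + e := ⟨_, (add_sub_cancel _ _).symm⟩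
  obtain ⟨e₂, he₂⟩ : ∃ e, theta2Red 0 q = 1 + e := ⟨_, (add_sub_cancel _ _).symm⟩
  obtain ⟨e₃, he₃⟩ : ∃ e, theta3 0 q = 1 + 2 * q + e := ⟨_, (add_sub_cancel _ _).symm⟩
  obtain ⟨e₄, he₄⟩ : ∃ e, theta4 θ q = 1 - 2 * q * (2 * Real.cos θ ^ 2 - 1) + e :=
    ⟨_, (add_sub_cancel _ _).symm⟩
  have h₁ : |e₁| ≤ 2 * q ^ 2 := by simpa [he₁] using abs_theta1Red_sub_le hq' θ
  have h₂ : |e₂| ≤ 2 * q ^ 2 := by simpa [he₂] using abs_theta2Red_sub_le hq' 0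
  have h₃ : |e₃| ≤ 4 * q ^ 2 := by simpa [he₃] using abs_theta3_sub_le hq' 0
  have h₄ : |e₄| ≤ 4 * q ^ 2 := by simpa [he₄, Real.cos_two_mul] using abs_theta4_sub_le hq' θ
  rw [jacobiSn, hζ, he₁, he₂, he₃, he₄, div_mul_div_comm]
  have hs := Real.abs_sin_le_one θ
  have hc : Real.cos θ ^ 2 ≤ 1 := Real.cos_sq_le_one θ
  have hc0 := sq_nonneg (Real.cos θ)
  set s := Real.sin θ
  set x := Real.cos θ ^ 2
  have hq2 : q ^ 2 ≤ 1 / 10000 := by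
    rw [← sq_abs]; nlinarith [abs_nonneg q]
  have hA : |1 + 2 * q| ≤ 2 := by rw [abs_le] at hq ⊢; constructor <;> linarith
  have hx : |2 * x - 1| ≤ 1 := by rw [abs_le]; constructor <;> linarith
  have hqx : |2 * q * (2 * x - 1)| ≤ 1 / 50 := by
    rw [abs_mul, abs_mul, abs_two]; nlinarith [abs_nonneg q, abs_nonneg (2 * x - 1)]
  have hB : |1 - 2 * q * (2 * x - 1)| ≤ 2 := by
    rw [abs_le] at hqx ⊢; constructor <;> linarith
  have hy : |s * (1 + 4 * q * x)| ≤ 2 := by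
    have : |1 + 4 * q * x| ≤ 2 := by
      rw [abs_le] at hq ⊢; constructor <;> nlinarith
    rw [abs_mul]; nlinarith [abs_nonneg s, abs_nonneg (1 + 4 * q * x)]
  set A := 1 + 2 * q
  set B := 1 - 2 * q * (2 * x - 1)
  set y := s * (1 + 4 * q * x)
  have hD : 9 / 10 ≤ (1 + e₂) * (B + e₄) := by
    have : 97 / 100 ≤ B + e₄ := by
      rw [abs_le] at h₄ hqx; simp only [B]; linarith
    have : 99 / 100 ≤ 1 + e₂ := by rw [abs_le] at h₂; linarith
    nlinarith
  have hN : |A * s - y * B| ≤ 8 * q ^ 2 := by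
    have : A * s - y * B = 8 * q ^ 2 * (s * x * (2 * x - 1)) := by simp only [A, B, y]; ring
    rw [this, abs_mul, abs_of_nonneg (by positivity)]
    have : |s * x * (2 * x - 1)| ≤ 1 := by
      rw [abs_mul, abs_mul, abs_of_nonneg hc0]
      exact mul_le_one₀ (mul_le_one₀ hs hc0 hc) (abs_nonneg _) hx
    nlinarith [sq_nonneg q]
  have key : ∀ {a b α β : ℝ}, |a| ≤ α → |b| ≤ β → |a * b| ≤ α * β := fun ha hb => by
    rw [abs_mul]; exact mul_le_mul ha hb (abs_nonneg _) ((abs_nonneg _).trans ha)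
  have hdiff : (A + e₃) * (s + e₁) / ((1 + e₂) * (B + e₄)) - y =
      ((A * s - y * B) + A * e₁ + e₃ * s + e₃ * e₁ - y * e₄ - y * (e₂ * B) - y * (e₂ * e₄)) /
        ((1 + e₂) * (B + e₄)) := by
    rw [eq_div_iff (by linarith), sub_mul, div_mul_cancel₀ _ (by linarith)]
    ring
  rw [hdiff, abs_div, abs_of_pos (by linarith : 0 < (1 + e₂) * (B + e₄)),
    div_le_iff₀ (by linarith)]
  have k₁ := abs_le.1 (key hA h₁)
  have k₂ := abs_le.1 (key h₃ hs)
  have k₃ := abs_le.1 (key h₃ h₁)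
  have k₄ := abs_le.1 (key hy h₄)
  have k₅ := abs_le.1 (key hy (key h₂ hB))
  have k₆ := abs_le.1 (key hy (key h₂ h₄))
  have k₀ := abs_le.1 hN
  have hq4 : q ^ 2 * q ^ 2 ≤ 1 / 10000 * q ^ 2 :=
    mul_le_mul_of_nonneg_right hq2 (sq_nonneg q)
  -- The seven terms of the numerator add up to at most `32q² + 24q⁴`.
  have hfin : 48 * q ^ 2 ≤ 60 * q ^ 2 * ((1 + e₂) * (B + e₄)) := by
    linarith [mul_le_mul_of_nonneg_left hD (sq_nonneg q), sq_nonneg q]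
  refine le_trans ?_ hfin
  clear_value A B y
  have := sq_nonneg q
  rw [abs_le]
  constructor <;> linarith [k₀.1, k₀.2, k₁.1, k₁.2, k₂.1, k₂.2, k₃.1, k₃.2, k₄.1, k₄.2, k₅.1,
    k₅.2, k₆.1, k₆.2]

/-! ### Scalar inequalities between `θ̂` and `θ`, with `p = -q`. -/

/-- The conclusions are the hypotheses of `mul_edgeForm_le` for `l = 1 + 4p`, rearranged. They are
checked after squaring, where the slacks are `8pc³(1 + c)` and `8pc³(1 - c)` to first order in `p`.
-/
lemma mass_bounds_of_sq_bounds {r c p C : ℝ} (hr : 0 < r) (hc : r ≤ c) (hrc : r ^ 2 ≤ 1 - c ^ 2)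
    (hp : 0 ≤ p) (hp1 : p ≤ 1 / 200) (hpr : p ≤ r ^ 5 / 200) (hC : 0 ≤ C) (hC1 : C ^ 2 ≤ 1)
    (hlo : c ^ 2 + 8 * p * (1 - c ^ 2) * c ^ 2 - 200 * p ^ 2 ≤ C ^ 2)
    (hhi : C ^ 2 ≤ c ^ 2 + 8 * p * (1 - c ^ 2) * c ^ 2 + 200 * p ^ 2) :
    C * (1 - 4 * p * c) ≤ c * (1 + 4 * p) ∧ c * (1 + 4 * p) ≤ C * (1 + 4 * p * c) := by
  have hc0 : 0 < c := hr.trans_le hc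
  have hc2 : c ^ 2 ≤ 1 := by linarith [sq_nonneg r]
  have hc1 : c ≤ 1 := by rwa [sq_le_one_iff₀ hc0.le] at hc2
  have hr3 : r ^ 3 ≤ c ^ 3 := pow_le_pow_left₀ hr.le hc 3
  -- Lower bound for the smaller slack; this is where the exponent 5 in the smallness condition
  -- originates.
  have hgap : r ^ 5 / 2 ≤ c ^ 3 * (1 - c) := by
    have : r ^ 2 / 2 ≤ 1 - c := by linarith [sq_nonneg (1 - c)]
    calc r ^ 5 / 2 = r ^ 3 * (r ^ 2 / 2) := by ring
      _ ≤ _ := mul_le_mul hr3 this (by positivity) (by positivity)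
  have hpg : 800 * p ^ 2 ≤ 8 * p * (c ^ 3 * (1 - c)) := by
    linarith [mul_le_mul_of_nonneg_left (hpr.trans (by linarith : _ ≤ c ^ 3 * (1 - c) / 100)) hp]
  have hpc : p * c ≤ 1 / 200 := by
    linarith [mul_le_mul_of_nonneg_left hc1 hp]
  have hpc0 : 0 ≤ p * c := by positivity
  have hp2 : 0 ≤ p ^ 2 := sq_nonneg p
  have hp2c : p ^ 2 * c ^ 2 ≤ p ^ 2 := mul_le_of_le_one_right hp2 hc2
  have hp2C : p ^ 2 * c ^ 2 * C ^ 2 ≤ p ^ 2 :=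
    (mul_le_of_le_one_right (by positivity) hC1).trans hp2c
  have hX : 0 ≤ p * (1 - c ^ 2) * c ^ 2 := mul_nonneg (mul_nonneg hp (by linarith)) (sq_nonneg c)
  have hc4 : 0 ≤ p * c ^ 4 := by positivity
  have hX' := mul_nonneg hpc0 hX
  have hp3 : p * c * p ^ 2 ≤ 1 / 200 * p ^ 2 := mul_le_mul_of_nonneg_right hpc hp2
  have hp3' : 0 ≤ p * c * p ^ 2 := by positivity
  have hlo' := mul_le_mul_of_nonneg_right hlo (by linarith : 0 ≤ 1 + 8 * (p * c))
  have hhi' := mul_le_mul_of_nonneg_right hhi (by linarith : 0 ≤ 1 - 8 * (p * c))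
  have hpos : 0 ≤ p ^ 2 * c ^ 2 * C ^ 2 := by positivity
  have hpos' : 0 ≤ p ^ 2 * c ^ 2 := by positivity
  have hc3 : p * c ^ 3 * (1 - c) ≤ p * c ^ 3 * (1 + c) :=
    mul_le_mul_of_nonneg_left (by linarith) (by positivity)
  constructor
  · refine (abs_le_of_sq_le_sq' ?_ (by positivity)).2
    linarith
  · refine (abs_le_of_sq_le_sq' ?_ (by positivity)).2
    linarith

lemma sq_bounds_of_abs_sub_le {r p s c x : ℝ} (hr : 0 < r) (hp : 0 ≤ p) (hr1 : r ≤ 1)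
    (hpr : p ≤ r ^ 2 / 200) (hs : r ≤ s) (hc : r ≤ c) (hsc : s ^ 2 + c ^ 2 = 1)
    (hx : |x - s * (1 - 4 * p * c ^ 2)| ≤ 60 * p ^ 2) :
    0 < x ∧ |x ^ 2 - (s ^ 2 - 8 * p * s ^ 2 * c ^ 2)| ≤ 200 * p ^ 2 ∧ 0 < 1 - x ^ 2 := by
  have hc2 : c ^ 2 ≤ 1 := by linarith [sq_nonneg s]
  have hs2 : s ^ 2 ≤ 1 := by linarith [sq_nonneg c]
  have hs0 : 0 < s := hr.trans_le hs
  have hs1 : s ≤ 1 := by rwa [sq_le_one_iff₀ hs0.le] at hs2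
  have hr2 : r ^ 2 ≤ r := by rw [sq]; exact mul_le_of_le_one_right hr.le hr1
  have hp1 : p ≤ 1 / 200 := by linarith
  have hpc : p * c ^ 2 ≤ p := mul_le_of_le_one_right hp hc2
  have hpc0 : 0 ≤ p * c ^ 2 := by positivity
  have hp2 : p ^ 2 ≤ p / 200 := by
    linarith [mul_le_mul_of_nonneg_left hp1 hp]
  have hy0 : r * (98 / 100) ≤ s * (1 - 4 * p * c ^ 2) :=
    mul_le_mul hs (by linarith) (by norm_num) hs0.le
  have hy1 : s * (1 - 4 * p * c ^ 2) ≤ 1 := mul_le_one₀ hs1 (by linarith) (by linarith)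
  have hy2 : |(s * (1 - 4 * p * c ^ 2)) ^ 2 - (s ^ 2 - 8 * p * s ^ 2 * c ^ 2)| ≤ 16 * p ^ 2 := by
    have e : (s * (1 - 4 * p * c ^ 2)) ^ 2 - (s ^ 2 - 8 * p * s ^ 2 * c ^ 2) =
      16 * p ^ 2 * (s ^ 2 * (c ^ 2 * c ^ 2)) := by ring
    rw [e, abs_of_nonneg (by positivity)]
    exact mul_le_of_le_one_right (by positivity)
      (mul_le_one₀ hs2 (by positivity) (mul_le_one₀ hc2 (by positivity) hc2))
  generalize s * (1 - 4 * p * c ^ 2) = y at *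
  have hx' := abs_le.1 hx
  have hx0 : 0 < x := by linarith
  have hxy : |x ^ 2 - y ^ 2| ≤ 60 * p ^ 2 * 3 := by
    rw [sq_sub_sq, abs_mul, mul_comm]
    refine mul_le_mul hx ?_ (abs_nonneg _) (by positivity)
    rw [abs_of_pos (by linarith)]
    linarith
  -- `60 · 3 + 16 ≤ 200`.
  have hx2 : |x ^ 2 - (s ^ 2 - 8 * p * s ^ 2 * c ^ 2)| ≤ 200 * p ^ 2 :=
    (abs_sub_le _ (y ^ 2) _).trans (by linarith [sq_nonneg p])
  refine ⟨hx0, hx2, ?_⟩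
  have hrc2 : r ^ 2 ≤ c ^ 2 := pow_le_pow_left₀ hr.le hc 2
  have : 0 ≤ 8 * p * s ^ 2 * c ^ 2 := by positivity
  have : 0 < r ^ 2 := by positivity
  linarith [(abs_le.1 hx2).2]

lemma cos_isingAngle_bounds {r q θ : ℝ} (hr : 0 < r) (hq : q ≤ 0) (hq' : -q ≤ r ^ 5 / 200)
    (hs : r ≤ Real.sin θ) (hc : r ≤ Real.cos θ) :
    0 < Real.sin (isingAngle q θ) ∧ 0 < Real.cos (isingAngle q θ) ∧
    Real.cos (isingAngle q θ) * (1 + 4 * q * Real.cos θ) ≤ Real.cos θ * (1 - 4 * q) ∧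
    Real.cos θ * (1 - 4 * q) ≤ Real.cos (isingAngle q θ) * (1 - 4 * q * Real.cos θ) := by
  obtain ⟨p, rfl⟩ : ∃ p, q = -p := ⟨-q, (neg_neg q).symm⟩
  have hp : 0 ≤ p := by linarith
  have hsc := Real.sin_sq_add_cos_sq θ
  rw [neg_neg] at hq'
  have hs1 := Real.sin_le_one θ
  have hr1 : r ≤ 1 := hs.trans hs1
  have hp1 : p ≤ 1 / 200 := hq'.trans (by
    have := pow_le_one₀ hr.le hr1 (n := 5); linarith)
  have hpr2 : p ≤ r ^ 2 / 200 := hq'.trans (by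
    have := pow_le_pow_of_le_one hr.le hr1 (by norm_num : 2 ≤ 5); linarith)
  have hx := abs_jacobiSn_sub_le (q := -p) (by rw [abs_neg, abs_of_nonneg hp]; linarith) θ
  rw [neg_sq, mul_neg, neg_mul, ← sub_eq_add_neg] at hx
  obtain ⟨hx0, hx2, hC2⟩ := sq_bounds_of_abs_sub_le hr hp hr1 hpr2 hs hc hsc hx
  rw [isingAngle]
  generalize jacobiSn (-p) (2 * ellipticK (-p) / Real.pi * θ) = x at *
  -- Without this bound `arcsin` would be truncated and `sin θ̂` would differ from `sn`.
  have hx1 : x ≤ 1 := by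
    rw [← sq_le_one_iff₀ hx0.le]; linarith
  rw [Real.sin_arcsin (by linarith) hx1, Real.cos_arcsin]
  have hC := Real.sqrt_pos.2 hC2
  have hCsq := Real.sq_sqrt hC2.le
  have hs2 : Real.sin θ ^ 2 = 1 - Real.cos θ ^ 2 := by linarith
  have hrc : r ^ 2 ≤ 1 - Real.cos θ ^ 2 := by rw [← hs2]; exact pow_le_pow_left₀ hr.le hs 2
  rw [hs2, abs_le] at hx2
  obtain ⟨h₁, h₂⟩ := mass_bounds_of_sq_bounds hr hc hrc hp hp1 hq' hC.le
    (by linarith [sq_nonneg x]) (by linarith) (by linarith)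
  refine ⟨hx0, hC, ?_, ?_⟩ <;> linarith

/-! ### Quadratic forms on antiperiodic sequences. -/

/-- The quadratic form `((a² + b²) cos θ - 2ab) / sin θ`, the minimum of `∫₀^θ (f'² - f²)` over the
functions `f` with boundary values `a` and `b`. -/
noncomputable def edgeForm (θ a b : ℝ) : ℝ :=
  ((a ^ 2 + b ^ 2) * Real.cos θ - 2 * a * b) / Real.sin θ

/-- Gluing two functions along a common value `x` gives a competitor on the longer interval. The gap
is a square, zero exactly when `x` is the value at `α` of the solution of `f'' = -f` with end values
`a` and `b`. -/
lemma edgeForm_add_le {α β : ℝ} (hα : 0 < α) (hβ : 0 < β) (h : α + β < Real.pi) (a x b : ℝ) :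
    edgeForm (α + β) a b ≤ edgeForm α a x + edgeForm β x b := by
  have sα : 0 < Real.sin α := Real.sin_pos_of_pos_of_lt_pi hα (by linarith)
  have sβ : 0 < Real.sin β := Real.sin_pos_of_pos_of_lt_pi hβ (by linarith)
  have sαβ : 0 < Real.sin (α + β) := Real.sin_pos_of_pos_of_lt_pi (by linarith) h
  have hα2 := Real.sin_sq_add_cos_sq α
  have hβ2 := Real.sin_sq_add_cos_sq β
  have key : edgeForm α a x + edgeForm β x b - edgeForm (α + β) a b =
      (x * Real.sin (α + β) - a * Real.sin β - b * Real.sin α) ^ 2 /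
        (Real.sin α * Real.sin β * Real.sin (α + β)) := by
    rw [edgeForm, edgeForm, edgeForm, div_add_div _ _ sα.ne' sβ.ne',
      div_sub_div _ _ (by positivity) sαβ.ne']
    congr 1
    rw [Real.sin_add, Real.cos_add]
    generalize Real.sin α = s at *
    generalize Real.sin β = t at *
    generalize Real.cos α = c at *
    generalize Real.cos β = d at *
    have hs : s ^ 2 = 1 - c ^ 2 := by linarith
    have ht : t ^ 2 = 1 - d ^ 2 := by linarith
    linear_combination (b ^ 2 * s ^ 2) * ht + a ^ 2 * t ^ 2 * hs
  have : 0 ≤ edgeForm α a x + edgeForm β x b - edgeForm (α + β) a b := by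
    rw [key]; positivity
  linarith

lemma edgeForm_sum_le {θ X : ℕ → ℝ} (k : ℕ) (hθ : ∀ s ≤ k, 0 < θ s)
    (h : ∑ s ∈ Finset.range (k + 1), θ s < Real.pi) :
    edgeForm (∑ s ∈ Finset.range (k + 1), θ s) (X 0) (X (k + 1)) ≤
      ∑ s ∈ Finset.range (k + 1), edgeForm (θ s) (X s) (X (s + 1)) := by
  induction k with
  | zero => simp
  | succ k ih =>
    rw [Finset.sum_range_succ θ (k + 1)] at h ⊢
    rw [Finset.sum_range_succ _ (k + 1)]
    have hk := hθ (k + 1) le_rfl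
    refine (edgeForm_add_le (Finset.sum_pos (fun s hs => hθ s ?_) ⟨0, by simp⟩) hk h _ _ _).trans
      (add_le_add_left (ih (fun s hs => hθ s (by omega)) (by linarith)) _)
    rw [Finset.mem_range] at hs; omega

/-- Nonnegativity of the critical quadratic form on antiperiodic sequences. -/
lemma sum_edgeForm_nonneg {θ X : ℕ → ℝ} {n : ℕ} (hθ : ∀ s < n, 0 < θ s ∧ θ s < Real.pi)
    (h : ∑ s ∈ Finset.range n, θ s = Real.pi) (hX : X n = -X 0) :
    0 ≤ ∑ s ∈ Finset.range n, edgeForm (θ s) (X s) (X (s + 1)) := by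
  obtain _ | _ | k := n
  · simp
  · have := (hθ 0 one_pos).2
    simp at h
    linarith
  · rw [Finset.sum_range_succ _ (k + 1)] at h ⊢
    have hk := hθ (k + 1) (by omega)
    have := edgeForm_sum_le (X := X) k (fun s hs => (hθ s (by omega)).1) (by linarith)
    -- The merged edges have angle `π - θ (k + 1)`. Its cosine is opposite to that of the last edge,
    -- and `X n = -X 0` flips the cross term, so the two forms sum to zero.
    refine le_trans (le_of_eq ?_) (add_le_add_left this _)
    rw [eq_sub_of_add_eq h, hX, edgeForm, edgeForm, Real.sin_pi_sub, Real.cos_pi_sub]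
    ring

/-- Comparison of a massive edge form with a multiple of the critical one. -/
lemma mul_edgeForm_le {l θ φ : ℝ} (hs : 0 < Real.sin θ) (hc : 0 < Real.cos θ)
    (hs' : 0 < Real.sin φ) (hc' : 0 < Real.cos φ)
    (h₁ : Real.cos φ * (1 + Real.cos θ) ≤ l * Real.cos θ * (1 + Real.cos φ))
    (h₂ : l * Real.cos θ * (1 - Real.cos φ) ≤ Real.cos φ * (1 - Real.cos θ)) (a b : ℝ) :
    l * edgeForm θ a b ≤ Real.tan θ * (((a - b * Real.cos φ) / Real.sin φ) ^ 2 - a ^ 2) := by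
  have e := Real.sin_sq_add_cos_sq θ
  have e' := Real.sin_sq_add_cos_sq φ
  have hl : ((a - b * Real.cos φ) / Real.sin φ) ^ 2 - a ^ 2 =
      Real.cos φ * ((a ^ 2 + b ^ 2) * Real.cos φ - 2 * a * b) / Real.sin φ ^ 2 := by
    rw [div_pow, eq_div_iff (by positivity), sub_mul, div_mul_cancel₀ _ (by positivity)]
    linear_combination -a ^ 2 * e'
  rw [hl, edgeForm, Real.tan_eq_sin_div_cos]
  generalize Real.sin θ = s at *
  generalize Real.cos θ = c at *
  generalize Real.sin φ = S at *
  generalize Real.cos φ = C at *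
  rw [div_mul_div_comm, ← mul_div_assoc, div_le_div_iff₀ hs (by positivity)]
  have hc1 : c < 1 := by nlinarith
  have hC1 : C < 1 := by nlinarith
  have hs2 : s ^ 2 = (1 - c) * (1 + c) := by linarith
  have hS2 : S ^ 2 = (1 - C) * (1 + C) := by linarith
  -- Up to the factor 1/2, the cross-multiplied difference is the sum of these two terms: `h₁`
  -- controls `a = b`, `h₂` controls `a = -b`.
  have i₁ := mul_nonneg (mul_nonneg (mul_nonneg (sub_nonneg.2 hc1.le) (sub_nonneg.2 hC1.le))
    (sub_nonneg.2 h₁)) (sq_nonneg (a + b))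
  have i₂ := mul_nonneg (mul_nonneg (mul_nonneg (by linarith : 0 ≤ 1 + c) (by linarith : 0 ≤ 1 + C))
    (sub_nonneg.2 h₂)) (sq_nonneg (a - b))
  rw [← sub_nonneg]
  refine (half_pos one_pos |>.le |> fun h => mul_nonneg h (add_nonneg i₁ i₂)).trans_eq ?_
  linear_combination (l * c * ((a ^ 2 + b ^ 2) * c - 2 * a * b)) * hS2 -
    (C * ((a ^ 2 + b ^ 2) * C - 2 * a * b)) * hs2

/-! ### Rhombi, corner lifts and the Laplacian at a vertex. -/

namespace Quad

lemma IsRhombus.rotation {δ : ℝ} {z : Quad} (hz : z.IsRhombus δ) (hδ : 0 < δ) :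
    z.u 1 - z.v 0 = (z.u 0 - z.v 0) * Complex.exp (2 * z.halfAngle * Complex.I) := by
  have n₀ : ‖z.u 0 - z.v 0‖ = δ := by rw [← dist_eq_norm, dist_comm, hz.side]
  have n₁ : ‖z.u 1 - z.v 0‖ = δ := by rw [← dist_eq_norm, dist_comm, hz.side]
  have h₀ : z.u 0 - z.v 0 ≠ 0 := by rw [← norm_pos_iff, n₀]; exact hδ
  have h₁ : z.u 1 - z.v 0 ≠ 0 := by rw [← norm_pos_iff, n₁]; exact hδ
  have hangle : 2 * z.halfAngle = ((z.u 1 - z.v 0) / (z.u 0 - z.v 0)).arg := by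
    rw [halfAngle, EuclideanGeometry.angle_comm, EuclideanGeometry.angle, vsub_eq_sub, vsub_eq_sub,
      Complex.angle_eq_abs_arg h₁ h₀, abs_of_nonneg (Complex.arg_nonneg_iff.2 hz.ccw.le)]
    ring
  have hw := Complex.norm_mul_exp_arg_mul_I ((z.u 1 - z.v 0) / (z.u 0 - z.v 0))
  rw [norm_div, n₀, n₁, div_self hδ.ne', Complex.ofReal_one, one_mul, ← hangle] at hw
  push_cast at hw
  rw [hw, mul_div_cancel₀ _ h₀]

/-- Turns the lower bound on white angles into an upper bound on `halfAngle`. -/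
lemma IsRhombus.angle_white {δ : ℝ} {z : Quad} (hz : z.IsRhombus δ) :
    ∠ (z.v 0) (z.u 0) (z.v 1) = Real.pi - 2 * z.halfAngle := by
  have h : z.v 1 - z.u 0 = z.u 1 - z.v 0 := by linear_combination hz.parallelogram
  rw [halfAngle, EuclideanGeometry.angle, EuclideanGeometry.angle, vsub_eq_sub, vsub_eq_sub,
    vsub_eq_sub, vsub_eq_sub, h, ← neg_sub (z.u 0), InnerProductGeometry.angle_neg_left]
  ring

end Quad

namespace IsoradialGrid

variable {δ : ℝ} {Λ : IsoradialGrid δ}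

lemma BAP.halfAngle_mem {θ₀ : ℝ} (h : Λ.BAP θ₀) {z : Quad} (hz : z ∈ Λ.quads) :
    θ₀ ≤ z.halfAngle ∧ z.halfAngle ≤ Real.pi / 2 - θ₀ := by
  obtain ⟨h₁, h₂⟩ := h z hz
  rw [(Λ.rhombus z hz).angle_white] at h₂
  rw [Quad.halfAngle] at *
  constructor <;> linarith

lemma CornerLift.normSq_η_pos (hδ : 0 < δ) (c : Λ.CornerLift) : 0 < Complex.normSq c.η := by
  obtain ⟨z, hz, p, q, hv, hu⟩ := c.isCorner
  have hd := (Λ.rhombus z hz).side p q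
  rw [hv, hu] at hd
  have h : c.v - c.u ≠ 0 := sub_ne_zero.2 (dist_pos.1 (hδ.trans_eq hd.symm))
  rw [Complex.normSq_pos]
  intro h0
  have h' : conj (c.v - c.u) ≠ 0 := (map_ne_zero _).2 h
  refine div_ne_zero (mul_ne_zero Complex.I_ne_zero h') (Complex.ofReal_ne_zero.2 hδ.ne') ?_
  rw [← c.η_sq, h0, zero_pow two_ne_zero]

/-- The increment of `H` along the black diagonal of a quad in terms of the values of `X` at the two
corners at one of the endpoints. -/
lemma primitive_sub_eq (hδ : 0 < δ) {m : ℝ} {X : Λ.CornerLift → ℝ} {H : ℂ → ℝ} {z : Quad}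
    (hz : z ∈ Λ.quads) (hX : PropagationAt m X z) (hH : PrimitiveAt X H z)
    (hs : 0 < Real.sin z.halfAngle) (hc : 0 < Real.cos z.halfAngle)
    (hs' : Real.sin (isingAngle (m * δ / 2) z.halfAngle) ≠ 0) {c c' : Λ.CornerLift}
    (h₀ : c.Over z 0 0) (h₁ : c'.Over z 0 1)
    (hη : c'.η = c.η * Complex.exp (-(z.halfAngle * Complex.I))) :
    H (z.v 1) - H (z.v 0) =
      ((X c - X c' * Real.cos (isingAngle (m * δ / 2) z.halfAngle)) /
        Real.sin (isingAngle (m * δ / 2) z.halfAngle)) ^ 2 - X c ^ 2 := by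
  have hη' : c'.η = c.η * (Real.cos z.halfAngle - Real.sin z.halfAngle * Complex.I) := by
    rw [hη, ← neg_mul, ← Complex.ofReal_neg, Complex.exp_mul_I, ← Complex.ofReal_cos,
      ← Complex.ofReal_sin, Real.cos_neg, Real.sin_neg]
    push_cast
    ring
  have hsq : (Complex.I * c'.η) ^ 2 = Complex.I * conj (z.v 1 - z.u 0) / δ := by
    have h : z.v 1 - z.u 0 = -(c'.v - c'.u) := by
      rw [h₁.1, h₁.2]; linear_combination (Λ.rhombus z hz).parallelogram
    rw [mul_pow, c'.η_sq, Complex.I_sq, h, map_neg]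
    ring
  -- The edge `(v₁ u₀)` is opposite to `(v₀ u₁)` with direction reversed, so its lifts are `± I *
  -- c'.η`; the plus sign gives the neighbour of `c`, since the relevant real part is `|c.η|² sin
  -- θ`.
  let c'' : Λ.CornerLift := ⟨z.v 1, z.u 0, Complex.I * c'.η, ⟨z, hz, 1, 0, rfl, rfl⟩, hsq⟩
  have hN := c.normSq_η_pos hδ
  rw [Complex.normSq_apply] at hN
  have n' : c.Neighbor c' := by
    rw [CornerLift.Neighbor, hη']
    simp only [Complex.mul_re, Complex.mul_im, Complex.conj_re, Complex.conj_im, Complex.sub_re,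
      Complex.sub_im, Complex.ofReal_re, Complex.ofReal_im, Complex.I_re, Complex.I_im]
    linarith [mul_pos hN hc]
  have n'' : c.Neighbor c'' := by
    rw [CornerLift.Neighbor, show c''.η = Complex.I * c'.η from rfl, hη']
    simp only [Complex.mul_re, Complex.mul_im, Complex.conj_re, Complex.conj_im, Complex.sub_re,
      Complex.sub_im, Complex.ofReal_re, Complex.ofReal_im, Complex.I_re, Complex.I_im]
    linarith [mul_pos hN hs]
  have e := hX 0 0 c c' c'' h₀ h₁ ⟨rfl, rfl⟩ n' n''
  rw [e, add_sub_cancel_left, mul_div_cancel_right₀ _ hs', ← e]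
  linarith [hH 0 0 c h₀, hH 1 0 c'' ⟨rfl, rfl⟩]

lemma quadsAt_eq_image {v : ℂ} {n : ℕ} {Z : ℕ → Quad}
    (h : Λ.quadsAt v = {z | ∃ s < n, z = Z s}) :
    Λ.quadsAt v = Z '' (Finset.range n : Set ℕ) := by
  rw [h]
  ext z
  simp [eq_comm]

lemma laplacianWeight_nonneg (v : ℂ)
    (h : ∀ z ∈ Λ.quadsAt v, 0 ≤ Real.sin (2 * z.halfAngle)) : 0 ≤ Λ.laplacianWeight v :=
  mul_nonneg (by positivity) (finsum_nonneg fun z => finsum_nonneg (h z))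

/-- Nonnegativity of the Laplacian under a comparison of the angles `θ̂` with the angles `θ`. -/
lemma laplacian_nonneg (hδ : 0 < δ) {m l : ℝ} (hl : 0 ≤ l) {v : ℂ} (hv : v ∈ Λ.black)
    (hang : ∀ z ∈ Λ.quadsAt v, 0 < z.halfAngle ∧ z.halfAngle < Real.pi / 2)
    (hpos : ∀ z ∈ Λ.quadsAt v, 0 < Real.sin (isingAngle (m * δ / 2) z.halfAngle) ∧
      0 < Real.cos (isingAngle (m * δ / 2) z.halfAngle))
    (hcmp : ∀ z ∈ Λ.quadsAt v,
      Real.cos (isingAngle (m * δ / 2) z.halfAngle) * (1 + Real.cos z.halfAngle) ≤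
        l * Real.cos z.halfAngle * (1 + Real.cos (isingAngle (m * δ / 2) z.halfAngle)) ∧
      l * Real.cos z.halfAngle * (1 - Real.cos (isingAngle (m * δ / 2) z.halfAngle)) ≤
        Real.cos (isingAngle (m * δ / 2) z.halfAngle) * (1 - Real.cos z.halfAngle))
    {X : Λ.CornerLift → ℝ} (hX : IsSpinor X) (hprop : ∀ z ∈ Λ.quadsAt v, PropagationAt m X z)
    {H : ℂ → ℝ} (hH : ∀ z ∈ Λ.quadsAt v, PrimitiveAt X H z) : 0 ≤ Λ.laplacian H v := by
  have hsin : ∀ z ∈ Λ.quadsAt v, 0 < Real.sin z.halfAngle := fun z hz =>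
    Real.sin_pos_of_pos_of_lt_pi (hang z hz).1 (by linarith [(hang z hz).2, Real.pi_pos])
  have hcos : ∀ z ∈ Λ.quadsAt v, 0 < Real.cos z.halfAngle := fun z hz =>
    Real.cos_pos_of_mem_Ioo ⟨by linarith [(hang z hz).1, Real.pi_pos], (hang z hz).2⟩
  obtain ⟨n, u, hun, hstar, hsum⟩ := Λ.black_star v hv
  let Z : ℕ → Quad := fun s => ⟨![v, u s + u (s + 1) - v], ![u s, u (s + 1)]⟩
  have hZ : Λ.quadsAt v = {z | ∃ s < n, z = Z s} := hstar
  have hmem : ∀ s < n, Z s ∈ Λ.quadsAt v := fun s hs => by rw [hZ]; exact ⟨s, hs, rfl⟩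
  let φ : ℕ → ℝ := fun s => ∑ t ∈ Finset.range s, (Z t).halfAngle
  have hφs : ∀ s, φ (s + 1) = φ s + (Z s).halfAngle := fun s => Finset.sum_range_succ _ _
  have hφn : φ n = Real.pi := by
    have : φ n = (∑ s ∈ Finset.range n, ∠ (u s) v (u (s + 1))) / 2 := by
      rw [Finset.sum_div]; rfl
    rw [this, hsum]; ring
  have hφlt : ∀ {s t}, s < t → t ≤ n → φ s < φ t := fun {s t} hst ht =>
    Finset.sum_lt_sum_of_subset (Finset.range_mono hst.le) (Finset.mem_range.2 hst) (by simp)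
      (hang _ (hmem s (by omega))).1
      fun j hj _ => (hang _ (hmem j (by rw [Finset.mem_range] at hj; omega))).1.le
  have hrot : ∀ s ≤ n, u s - v = (u 0 - v) * Complex.exp (2 * φ s * Complex.I) := by
    intro s
    induction s with
    | zero => simp [φ]
    | succ s ih =>
      intro hs
      have := (Λ.rhombus _ (hmem s hs).1).rotation hδ
      change u (s + 1) - v = (u s - v) * _ at this
      rw [this, ih (by omega), mul_assoc, ← Complex.exp_add, hφs]
      push_cast
      ring_nf
  have hn : 0 < n := Nat.pos_of_ne_zero fun h => by
    subst h; exact Real.pi_ne_zero (hφn.symm.trans (by simp [φ]))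
  have hdist : dist v (u 0) = δ := (Λ.rhombus _ (hmem 0 hn).1).side 0 0
  -- The Laplacian sums over a set of rhombi, the star over indices. No rhombus repeats: `u s = u t`
  -- forces `φ t - φ s` to be a multiple of `π`, whereas `φ` increases strictly within `[0, π)` for
  -- indices below `n`.
  have hinj : Set.InjOn Z (Finset.range n : Set ℕ) := by
    have : ∀ s t, s < t → t < n → Z s ≠ Z t := by
      intro s t hst ht he
      have hu : u s = u t := congrArg (fun z : Quad => z.u 0) he
      have h1 := hrot s (by omega)
      rw [hu, hrot t ht.le] at h1
      have h0 : u 0 - v ≠ 0 := sub_ne_zero.2 (dist_pos.1 (hδ.trans_eq hdist.symm)).symm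
      obtain ⟨k, hk⟩ := Complex.exp_eq_exp_iff_exists_int.1 (mul_left_cancel₀ h0 h1)
      have hk' : φ t - φ s = k * Real.pi := by
        have h2 : (2 * Complex.I) * ((φ t - φ s : ℝ) : ℂ) = (2 * Complex.I) * ((k * Real.pi : ℝ)) := by
          push_cast; linear_combination hk
        exact_mod_cast mul_left_cancel₀ (mul_ne_zero two_ne_zero Complex.I_ne_zero) h2
      have p0 := hφlt hst ht.le
      have p1 : φ t < φ n := hφlt ht le_rfl
      have p2 : 0 ≤ φ s := Finset.sum_nonneg fun j hj =>
        (hang _ (hmem j (by rw [Finset.mem_range] at hj; omega))).1.le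
      rw [hφn] at p1
      have k0 : 0 < (k : ℝ) := by
        by_contra! h
        linarith [mul_nonpos_of_nonpos_of_nonneg h Real.pi_pos.le]
      have k1 : (k : ℝ) < 1 := by
        by_contra! h
        linarith [mul_le_mul_of_nonneg_right h Real.pi_pos.le]
      norm_cast at k0 k1
      omega
    intro s hs t ht he
    simp only [Finset.coe_range, Set.mem_Iio] at hs ht
    rcases lt_trichotomy s t with h | h | h
    · exact (this s t h ht he).elim
    · exact h
    · exact (this t s h hs he.symm).elim
  obtain ⟨η₀, hη₀⟩ := IsAlgClosed.exists_pow_nat_eq (Complex.I * conj (v - u 0) / δ) two_pos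
  have hcorner : ∀ s ≤ n, Λ.IsCorner v (u s) := by
    intro s hs
    rcases hs.lt_or_eq with h | rfl
    · exact ⟨Z s, (hmem s h).1, 0, 0, rfl, rfl⟩
    · exact ⟨Z 0, (hmem 0 hn).1, 0, 0, rfl, hun.symm⟩
  -- A continuous choice of lifts around `v`. The index `n` is kept apart from `0`: it is the same
  -- corner with the other lift, because `φ n = π`.
  have hηsq : ∀ s ≤ n, (η₀ * Complex.exp (-(φ s * Complex.I))) ^ 2 =
      Complex.I * conj (v - u s) / δ := by
    intro s hs
    have h1 : v - u s = (v - u 0) * Complex.exp (2 * φ s * Complex.I) := by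
      linear_combination -hrot s hs
    rw [mul_pow, hη₀, h1, map_mul, ← Complex.exp_conj, ← Complex.exp_nat_mul]
    simp only [map_mul, Complex.conj_ofReal, Complex.conj_I, Complex.conj_ofNat]
    push_cast
    ring_nf
  let c : ∀ s, s ≤ n → Λ.CornerLift := fun s hs => ⟨v, u s, _, hcorner s hs, hηsq s hs⟩
  let x : ℕ → ℝ := fun s => if hs : s ≤ n then X (c s hs) else 0
  have hx : ∀ s (hs : s ≤ n), x s = X (c s hs) := fun s hs => dif_pos hs
  have hxn : x n = -x 0 := by
    rw [hx n le_rfl, hx 0 n.zero_le, ← hX]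
    congr 1
    ext1
    · rfl
    · exact hun
    · change η₀ * Complex.exp (-(φ n * Complex.I)) = -(η₀ * Complex.exp (-(φ 0 * Complex.I)))
      rw [hφn, Complex.exp_neg, Complex.exp_pi_mul_I]
      simp [φ]
  have hinc : ∀ s < n, H ((Z s).v 1) - H v =
      ((x s - x (s + 1) * Real.cos (isingAngle (m * δ / 2) (Z s).halfAngle)) /
        Real.sin (isingAngle (m * δ / 2) (Z s).halfAngle)) ^ 2 - x s ^ 2 := by
    intro s hs
    have hz := hmem s hs
    rw [hx s hs.le, hx (s + 1) hs]
    refine primitive_sub_eq hδ hz.1 (hprop _ hz) (hH _ hz) (hsin _ hz) (hcos _ hz)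
      (hpos _ hz).1.ne' (c := c s hs.le) (c' := c (s + 1) hs) ⟨rfl, rfl⟩ ⟨rfl, rfl⟩ ?_
    change η₀ * Complex.exp (-(φ (s + 1) * Complex.I)) =
      η₀ * Complex.exp (-(φ s * Complex.I)) * _
    rw [mul_assoc, ← Complex.exp_add, hφs]
    push_cast
    ring_nf
  refine mul_nonneg (inv_nonneg.2 (laplacianWeight_nonneg v fun z hz => ?_)) ?_
  · rw [Real.sin_two_mul]
    have := hsin z hz
    have := hcos z hz
    positivity
  · rw [quadsAt_eq_image hZ, finsum_mem_image hinj, finsum_mem_coe_finset]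
    have hcrit := sum_edgeForm_nonneg (θ := fun s => (Z s).halfAngle) (X := x) (n := n)
      (fun s hs => ⟨(hang _ (hmem s hs)).1,
        by linarith [(hang _ (hmem s hs)).2, Real.pi_pos]⟩) hφn hxn
    refine (mul_nonneg hl hcrit).trans ?_
    rw [Finset.mul_sum]
    refine Finset.sum_le_sum fun s hs => ?_
    rw [Finset.mem_range] at hs
    have hz := hmem s hs
    rw [hinc s hs]
    exact mul_edgeForm_le (hsin _ hz) (hcos _ hz) (hpos _ hz).1 (hpos _ hz).2 (hcmp _ hz).1
      (hcmp _ hz).2 _ _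

end IsoradialGrid

theorem mainTheorem12 (θ₀ : ℝ) (hθ₀ : 0 < θ₀) :
    ∃ ε : ℝ, 0 < ε ∧ ∀ m δ : ℝ, m ≤ 0 → 0 < δ → |m| * δ ≤ ε → ∀ Λ : IsoradialGrid δ, Λ.BAP θ₀ →
      (∀ v ∈ Λ.black, ∀ X : Λ.CornerLift → ℝ, IsoradialGrid.IsSpinor X →
        (∀ z ∈ Λ.quadsAt v, IsoradialGrid.PropagationAt m X z) →
        ∀ H : ℂ → ℝ, (∀ z ∈ Λ.quadsAt v, IsoradialGrid.PrimitiveAt X H z) →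
          0 ≤ Λ.laplacian H v) ∧
      (∀ X : Λ.CornerLift → ℝ, IsoradialGrid.IsSpinor X →
        (∀ z ∈ Λ.quads, IsoradialGrid.PropagationAt m X z) →
        ∀ H : ℂ → ℝ, (∀ z ∈ Λ.quads, IsoradialGrid.PrimitiveAt X H z) →
          Λ.SubharmonicOnBlack H) := by
  have hπ := Real.pi_pos
  -- The cap keeps `α` in the range where `sin` is positive and increasing; `sin α` then bounds both
  -- `sin θ_z` and `cos θ_z` from below.
  set α := min θ₀ (Real.pi / 4)
  have hα : 0 < α := lt_min hθ₀ (by linarith)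
  have hα' : α ≤ Real.pi / 4 := min_le_right _ _
  have hr : 0 < Real.sin α := Real.sin_pos_of_pos_of_lt_pi hα (by linarith)
  refine ⟨Real.sin α ^ 5 / 100, by positivity, fun m δ hm hδ hmδ Λ hΛ => ?_⟩
  have hq : m * δ / 2 ≤ 0 := by
    linarith [mul_nonpos_of_nonpos_of_nonneg hm hδ.le]
  have hq' : -(m * δ / 2) ≤ Real.sin α ^ 5 / 200 := by
    rw [abs_of_nonpos hm] at hmδ
    linarith
  have hang : ∀ z ∈ Λ.quads, α ≤ z.halfAngle ∧ z.halfAngle ≤ Real.pi / 2 - α := fun z hz => by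
    have h₀ : α ≤ θ₀ := min_le_left _ _
    have h := hΛ.halfAngle_mem hz
    exact ⟨h₀.trans h.1, h.2.trans (by linarith)⟩
  have hbounds := fun z (hz : z ∈ Λ.quads) =>
    cos_isingAngle_bounds (q := m * δ / 2) (θ := z.halfAngle) hr hq hq'
    (Real.sin_le_sin_of_le_of_le_pi_div_two (by linarith) (by linarith [(hang z hz).2])
      (hang z hz).1)
    (by
      rw [← Real.cos_pi_div_two_sub]
      exact Real.cos_le_cos_of_nonneg_of_le_pi (by linarith [(hang z hz).1]) (by linarith)
        (hang z hz).2)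
  have hlocal : ∀ v ∈ Λ.black, ∀ X : Λ.CornerLift → ℝ, IsoradialGrid.IsSpinor X →
      (∀ z ∈ Λ.quadsAt v, IsoradialGrid.PropagationAt m X z) →
      ∀ H : ℂ → ℝ, (∀ z ∈ Λ.quadsAt v, IsoradialGrid.PrimitiveAt X H z) →
        0 ≤ Λ.laplacian H v := fun v hv X hX hprop H hH => by
    refine IsoradialGrid.laplacian_nonneg hδ (l := 1 - 4 * (m * δ / 2)) (by linarith) hv
      (fun z hz => ⟨by linarith [(hang z hz.1).1], by linarith [(hang z hz.1).2]⟩)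
      (fun z hz => ⟨(hbounds z hz.1).1, (hbounds z hz.1).2.1⟩) (fun z hz => ?_) hX hprop hH
    obtain ⟨-, -, h₁, h₂⟩ := hbounds z hz.1
    constructor <;> linarith
  exact ⟨hlocal, fun X hX hprop H hH v hv =>
    hlocal v hv X hX (fun z hz => hprop z hz.1) H fun z hz => hH z hz.1⟩
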